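/- **Definitions.** A real Archimedean vector lattice is a real vector space with a compatible lattice order in which $nf\le g$ for all $n\in\mathbb{N}=\{1,2,\dots\}$ implies $f\le 0$; a linear map $T$ between such spaces is a vector lattice homomorphism if $T|f|=|Tf|$ for all $f$, and a bilinear map on $E\times F$ is a vector lattice bimorphism if it is a vector lattice homomorphism in each variable whenever the other variable is fixed at a positive element. The Fremlin tensor product $E\bar\otimes F$ of Archimedean vector lattices $E,F$ is the (essentially unique) Archimedean vector lattice with a vector lattice bimorphism $\bar\otimes\colon E\times F\to E\bar\otimes F$ such that every vector lattice bimorphism $T$ from $E\times F$ into an Archimedean vector lattice $H$ has the form $T=S\circ\bar\otimes$ for a unique vector lattice homomorphism $S\colon E\bar\otimes F\to H$. An Archimedean vector lattice $E$ is square mean complete if $\sup\{f\cos\theta+g\sin\theta:\theta\in[0,2\pi]\}$ exists in $E$ for all $f,g\in E$. An Archimedean modulus on a complex vector space $V$ is a map $m\colon V\to V$ such that, for all $f,g\in V$ and $\alpha\in\mathbb{C}$, $m(m(f))=m(f)$; $m(\alpha f)=|\alpha|\,m(f)$; $m\bigl(m(m(f)+m(g))-m(f+g)\bigr)=m(f)+m(g)-m(f+g)$;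 $V$ is the complex linear span of $m(V)$; and if $m(m(g)-n\,m(f))=m(g)-n\,m(f)$ for every $n\in\mathbb{N}$, then $f=0$. The vector space complexification $E_{\mathbb{C}}=E\oplus iE$ is an Archimedean complex vector lattice if there is an Archimedean modulus $m$ on $E_{\mathbb{C}}$ that extends the absolute value of $E$, that is, $m(f)=|f|$ for all $f\in E$. **Theorem.** If $X$ and $Y$ are uncountable compact metrizable spaces, then the Fremlin tensor product $C(X)\bar\otimes C(Y)$ of the spaces of continuous real functions is not square mean complete, and its vector space complexification $(C(X)\bar\otimes C(Y))_{\mathbb{C}}$ is not an Archimedean complex vector lattice. -/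

import Mathlib

open scoped TensorProduct

universe u v w

/-! ### Real Archimedean vector lattices -/

/-- `E` is an Archimedean vector lattice over `ℝ`: a real vector space with a lattice order that is
compatible with the vector space operations, and in which `n • f ≤ g` for all positive integers `n`
forces `f ≤ 0`. -/
class ArchimedeanVectorLattice (E : Type u) [AddCommGroup E] [Lattice E] [Module ℝ E] : Prop
    extends IsOrderedAddMonoid E, PosSMulMono ℝ E where
  archimedean : ∀ f g : E, (∀ n : ℕ, 0 < n → n • f ≤ g) → f ≤ 0

/-- The space of continuous real functions, with the pointwise operations and order, is an
Archimedean vector lattice. -/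
instance ContinuousMap.instArchimedeanVectorLattice (X : Type u) [TopologicalSpace X] :
    ArchimedeanVectorLattice C(X, ℝ) where
  add_le_add_left _ _ h c x := add_le_add_left (h x) (c x)
  smul_le_smul_of_nonneg_left _ hr _ _ h x := mul_le_mul_of_nonneg_left (h x) hr
  archimedean f g h x := by
    change f x ≤ 0
    by_contra! hx
    obtain ⟨n, hn⟩ := exists_nat_gt (g x / f x)
    have h1 : (n + 1) • f x ≤ g x := h (n + 1) n.succ_pos x
    rw [div_lt_iff₀ hx] at hn
    rw [nsmul_eq_mul] at h1
    push_cast at h1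
    linarith

/-- A vector lattice homomorphism: a linear map that preserves absolute values. -/
def IsLatticeHom {E : Type u} {F : Type v} [AddCommGroup E] [Lattice E] [Module ℝ E]
    [AddCommGroup F] [Lattice F] [Module ℝ F] (T : E →ₗ[ℝ] F) : Prop :=
  ∀ f : E, T |f| = |T f|

/-- A vector lattice bimorphism: a bilinear map that is a vector lattice homomorphism in each
variable whenever the other variable is fixed at a positive element. -/
def IsLatticeBimorphism {E : Type u} {F : Type v} {G : Type w}
    [AddCommGroup E] [Lattice E] [Module ℝ E] [AddCommGroup F] [Lattice F] [Module ℝ F]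
    [AddCommGroup G] [Lattice G] [Module ℝ G] (T : E →ₗ[ℝ] F →ₗ[ℝ] G) : Prop :=
  (∀ g : F, 0 ≤ g → IsLatticeHom (T.flip g)) ∧ (∀ f : E, 0 ≤ f → IsLatticeHom (T f))

/-- The pair `(G, τ)` is an Archimedean vector lattice tensor product (a Fremlin tensor product) of
`E` and `F`. The universe `w` of the test spaces `H` is arbitrary. -/
structure IsArchimedeanTensorProduct {E F G : Type*}
    [AddCommGroup E] [Lattice E] [Module ℝ E] [AddCommGroup F] [Lattice F] [Module ℝ F]
    [AddCommGroup G] [Lattice G] [Module ℝ G] (τ : E →ₗ[ℝ] F →ₗ[ℝ] G) : Prop where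
  archimedean : ArchimedeanVectorLattice G
  bimorphism : IsLatticeBimorphism τ
  existsUnique_lift : ∀ (H : Type w) [AddCommGroup H] [Lattice H] [Module ℝ H]
    [ArchimedeanVectorLattice H] (T : E →ₗ[ℝ] F →ₗ[ℝ] H), IsLatticeBimorphism T →
    ∃! S : G →ₗ[ℝ] H, IsLatticeHom S ∧ ∀ f g, S (τ f g) = T f g

/-! ### The Fremlin tensor product

`FremlinTensor E F` is constructed as the Archimedean vector lattice presented by the generators
`f ⊗ g` and the relations saying that `(f, g) ↦ f ⊗ g` is a vector lattice bimorphism: formal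
vector lattice expressions in the generators, modulo the least congruence that contains the vector
lattice axioms and the bimorphism relations and is closed under the Archimedean rule. It is proved
below to be an Archimedean vector lattice tensor product of `E` and `F`. -/

namespace FremlinTensor

/-- Formal vector lattice expressions in the symbols `f ⊗ g`. -/
inductive Pre (E : Type u) (F : Type v) : Type (max u v)
  | of (f : E) (g : F) : Pre E F
  | zero : Pre E F
  | add (a b : Pre E F) : Pre E F
  | smul (r : ℝ) (a : Pre E F) : Pre E F
  | sup (a b : Pre E F) : Pre E F

section Construction

variable {E : Type u} {F : Type v} [AddCommGroup E] [Lattice E] [Module ℝ E]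
  [AddCommGroup F] [Lattice F] [Module ℝ F]

/-- The least congruence on formal expressions that contains the axioms of vector lattices and the
bimorphism relations, and is closed under the Archimedean rule. Recall `a ≤ b ↔ a ⊔ b = b`. -/
inductive Rel : Pre E F → Pre E F → Prop
  | refl (a) : Rel a a
  | symm {a b} : Rel a b → Rel b a
  | trans {a b c} : Rel a b → Rel b c → Rel a c
  | add_congr {a a' b b'} : Rel a a' → Rel b b' → Rel (.add a b) (.add a' b')
  | smul_congr (r : ℝ) {a a'} : Rel a a' → Rel (.smul r a) (.smul r a')
  | sup_congr {a a' b b'} : Rel a a' → Rel b b' → Rel (.sup a b) (.sup a' b')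
  | add_assoc (a b c) : Rel (.add (.add a b) c) (.add a (.add b c))
  | add_comm (a b) : Rel (.add a b) (.add b a)
  | zero_add (a) : Rel (.add .zero a) a
  | zero_smul (a) : Rel (.smul 0 a) .zero
  | one_smul (a) : Rel (.smul 1 a) a
  | mul_smul (r s : ℝ) (a) : Rel (.smul (r * s) a) (.smul r (.smul s a))
  | smul_add (r : ℝ) (a b) : Rel (.smul r (.add a b)) (.add (.smul r a) (.smul r b))
  | add_smul (r s : ℝ) (a) : Rel (.smul (r + s) a) (.add (.smul r a) (.smul s a))
  | sup_comm (a b) : Rel (.sup a b) (.sup b a)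
  | sup_assoc (a b c) : Rel (.sup (.sup a b) c) (.sup a (.sup b c))
  | sup_idem (a) : Rel (.sup a a) a
  | sup_add (a b c) : Rel (.add (.sup a b) c) (.sup (.add a c) (.add b c))
  | smul_sup (r : ℝ) (a b) : 0 ≤ r → Rel (.smul r (.sup a b)) (.sup (.smul r a) (.smul r b))
  | archimedean (a b) :
      (∀ n : ℕ, 0 < n → Rel (.sup (.smul n a) b) b) → Rel (.sup a .zero) .zero
  | of_add_left (f f' : E) (g : F) : Rel (.of (f + f') g) (.add (.of f g) (.of f' g))
  | of_smul_left (r : ℝ) (f : E) (g : F) : Rel (.of (r • f) g) (.smul r (.of f g))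
  | of_add_right (f : E) (g g' : F) : Rel (.of f (g + g')) (.add (.of f g) (.of f g'))
  | of_smul_right (r : ℝ) (f : E) (g : F) : Rel (.of f (r • g)) (.smul r (.of f g))
  | of_abs_left (f : E) (g : F) :
      0 ≤ g → Rel (.of |f| g) (.sup (.of f g) (.smul (-1) (.of f g)))
  | of_abs_right (f : E) (g : F) :
      0 ≤ f → Rel (.of f |g|) (.sup (.of f g) (.smul (-1) (.of f g)))

variable (E F) in
/-- Formal expressions up to the congruence `Rel`. -/
def preSetoid : Setoid (Pre E F) where
  r := Rel
  iseqv := ⟨Rel.refl, Rel.symm, Rel.trans⟩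

end Construction

end FremlinTensor

/-- The Fremlin tensor product of two vector lattices. -/
def FremlinTensor (E : Type u) (F : Type v) [AddCommGroup E] [Lattice E] [Module ℝ E]
    [AddCommGroup F] [Lattice F] [Module ℝ F] : Type (max u v) :=
  Quotient (FremlinTensor.preSetoid E F)

namespace FremlinTensor

section Structure

variable {E : Type u} {F : Type v} [AddCommGroup E] [Lattice E] [Module ℝ E]
  [AddCommGroup F] [Lattice F] [Module ℝ F]

/-- The class of a formal expression. -/
def mk (a : Pre E F) : FremlinTensor E F := Quotient.mk (preSetoid E F) a

theorem sound {a b : Pre E F} (h : Rel a b) : mk a = mk b := Quotient.sound h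

theorem exact {a b : Pre E F} (h : mk a = mk b) : Rel a b :=
  Quotient.exact (s := preSetoid E F) h

theorem ind {p : FremlinTensor E F → Prop} (h : ∀ a, p (mk a)) (x : FremlinTensor E F) : p x :=
  Quotient.ind h x

instance : Zero (FremlinTensor E F) := ⟨mk .zero⟩

instance : Add (FremlinTensor E F) :=
  ⟨Quotient.map₂ Pre.add fun _ _ h _ _ h' => Rel.add_congr h h'⟩

instance : SMul ℝ (FremlinTensor E F) :=
  ⟨fun r => Quotient.map (Pre.smul r) fun _ _ h => Rel.smul_congr r h⟩

/-- The supremum of two classes. -/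
def supAux : FremlinTensor E F → FremlinTensor E F → FremlinTensor E F :=
  Quotient.map₂ Pre.sup fun _ _ h _ _ h' => Rel.sup_congr h h'

instance : Neg (FremlinTensor E F) := ⟨fun x => (-1 : ℝ) • x⟩

theorem mk_zero : mk (.zero : Pre E F) = 0 := rfl
theorem mk_add (a b : Pre E F) : mk (.add a b) = mk a + mk b := rfl
theorem mk_smul (r : ℝ) (a : Pre E F) : mk (.smul r a) = r • mk a := rfl

protected theorem add_comm' (x y : FremlinTensor E F) : x + y = y + x := by
  induction x using ind; induction y using ind; exact sound (.add_comm _ _)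

protected theorem zero_add' (x : FremlinTensor E F) : 0 + x = x := by
  induction x using ind; exact sound (.zero_add _)

instance : AddCommGroup (FremlinTensor E F) where
  add_assoc x y z := by
    induction x using ind; induction y using ind; induction z using ind
    exact sound (.add_assoc _ _ _)
  zero_add := FremlinTensor.zero_add'
  add_zero x := by rw [FremlinTensor.add_comm', FremlinTensor.zero_add']
  add_comm := FremlinTensor.add_comm'
  neg_add_cancel x := by
    induction x using ind with | _ a
    refine sound (.trans (.add_congr (.refl _) (.symm (.one_smul a))) ?_)
    refine .trans (.symm (.add_smul _ _ _)) ?_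
    rw [neg_add_cancel]
    exact .zero_smul _
  nsmul := nsmulRec
  zsmul := zsmulRec

instance : Module ℝ (FremlinTensor E F) where
  one_smul x := by induction x using ind; exact sound (.one_smul _)
  mul_smul r s x := by induction x using ind; exact sound (.mul_smul _ _ _)
  smul_add r x y := by
    induction x using ind; induction y using ind; exact sound (.smul_add _ _ _)
  add_smul r s x := by induction x using ind; exact sound (.add_smul _ _ _)
  zero_smul x := by induction x using ind; exact sound (.zero_smul _)
  smul_zero r := by
    have h : mk (.smul 0 .zero : Pre E F) = mk .zero := sound (.zero_smul _)
    rw [← mk_zero, ← h, ← mk_smul]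
    refine sound (.trans (.symm (.mul_smul _ _ _)) ?_)
    rw [mul_zero]
    exact .refl _

theorem supAux_comm (x y : FremlinTensor E F) : supAux x y = supAux y x := by
  induction x using ind; induction y using ind; exact sound (.sup_comm _ _)

theorem supAux_assoc (x y z : FremlinTensor E F) :
    supAux (supAux x y) z = supAux x (supAux y z) := by
  induction x using ind; induction y using ind; induction z using ind
  exact sound (.sup_assoc _ _ _)

theorem supAux_idem (x : FremlinTensor E F) : supAux x x = x := by
  induction x using ind; exact sound (.sup_idem _)

instance : SemilatticeSup (FremlinTensor E F) where
  sup := supAux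
  le x y := supAux x y = y
  le_refl := supAux_idem
  le_trans x y z h h' := by rw [← h', ← supAux_assoc, h]
  le_antisymm x y h h' := by rw [← h', supAux_comm, h]
  le_sup_left x y := by rw [← supAux_assoc, supAux_idem]
  le_sup_right x y := by rw [supAux_comm, supAux_assoc, supAux_idem]
  sup_le x y z h h' := by rw [supAux_assoc, h', h]

theorem mk_sup (a b : Pre E F) : mk (.sup a b) = mk a ⊔ mk b := rfl

theorem sup_add' (x y z : FremlinTensor E F) : (x ⊔ y) + z = (x + z) ⊔ (y + z) := by
  induction x using ind; induction y using ind; induction z using ind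
  exact sound (.sup_add _ _ _)

theorem smul_sup' {r : ℝ} (hr : 0 ≤ r) (x y : FremlinTensor E F) :
    r • (x ⊔ y) = r • x ⊔ r • y := by
  induction x using ind; induction y using ind
  exact sound (.smul_sup _ _ _ hr)

instance : IsOrderedAddMonoid (FremlinTensor E F) where
  add_le_add_left x y h z := by
    rw [← sup_eq_right] at h ⊢
    rw [← sup_add', h]

instance : Lattice (FremlinTensor E F) where
  inf x y := -(-x ⊔ -y)
  inf_le_left x y := by
    change -(-x ⊔ -y) ≤ x
    rw [neg_le]; exact le_sup_left
  inf_le_right x y := by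
    change -(-x ⊔ -y) ≤ y
    rw [neg_le]; exact le_sup_right
  le_inf x y z h h' := by
    change x ≤ -(-y ⊔ -z)
    rw [le_neg]; exact sup_le (neg_le_neg h) (neg_le_neg h')

instance : ArchimedeanVectorLattice (FremlinTensor E F) where
  smul_le_smul_of_nonneg_left r hr x y h := by
    rw [← sup_eq_right] at h ⊢
    rw [← smul_sup' hr, h]
  archimedean x y h := by
    induction x using ind with | _ a
    induction y using ind with | _ b
    rw [← sup_eq_right]
    refine sound (.archimedean a b fun n hn => exact ?_)
    have := h n hn
    rw [← Nat.cast_smul_eq_nsmul ℝ, ← sup_eq_right] at this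
    exact this

variable (E F) in
/-- The canonical bilinear map `(f, g) ↦ f ⊗ g`. -/
def tmul : E →ₗ[ℝ] F →ₗ[ℝ] FremlinTensor E F :=
  LinearMap.mk₂ ℝ (fun f g => mk (.of f g))
    (fun _ _ _ => sound (.of_add_left _ _ _)) (fun _ _ _ => sound (.of_smul_left _ _ _))
    (fun _ _ _ => sound (.of_add_right _ _ _)) (fun _ _ _ => sound (.of_smul_right _ _ _))

theorem tmul_apply (f : E) (g : F) : tmul E F f g = mk (.of f g) := rfl

theorem tmul_bimorphism : IsLatticeBimorphism (tmul E F) :=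
  ⟨fun g hg f => sound (.of_abs_left f g hg), fun f hf g => sound (.of_abs_right f g hf)⟩

variable {H : Type w} [AddCommGroup H] [Lattice H] [Module ℝ H]

/-- Evaluation of formal expressions along a bilinear map. -/
def eval (T : E →ₗ[ℝ] F →ₗ[ℝ] H) : Pre E F → H
  | .of f g => T f g
  | .zero => 0
  | .add a b => eval T a + eval T b
  | .smul r a => r • eval T a
  | .sup a b => eval T a ⊔ eval T b

theorem eval_eq [ArchimedeanVectorLattice H] {T : E →ₗ[ℝ] F →ₗ[ℝ] H}
    (hT : IsLatticeBimorphism T) {a b : Pre E F} (h : Rel a b) : eval T a = eval T b := by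
  induction h with
  | refl => rfl
  | symm _ ih => exact ih.symm
  | trans _ _ ih ih' => exact ih.trans ih'
  | add_congr _ _ ih ih' => simp only [eval, ih, ih']
  | smul_congr _ _ ih => simp only [eval, ih]
  | sup_congr _ _ ih ih' => simp only [eval, ih, ih']
  | add_assoc => exact add_assoc _ _ _
  | add_comm => exact add_comm _ _
  | zero_add => exact zero_add _
  | zero_smul => exact zero_smul _ _
  | one_smul => exact one_smul _ _
  | mul_smul => exact mul_smul _ _ _
  | smul_add => exact smul_add _ _ _
  | add_smul => exact add_smul _ _ _
  | sup_comm => exact sup_comm _ _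
  | sup_assoc => exact sup_assoc _ _ _
  | sup_idem => exact sup_idem _
  | sup_add => exact sup_add _ _ _
  | smul_sup r a b hr =>
    simp only [eval]
    rcases hr.eq_or_lt with rfl | hr
    · simp
    · exact (OrderIso.smulRight hr : H ≃o H).map_sup _ _
  | archimedean a b _ ih =>
    simp only [eval, sup_eq_right] at ih ⊢
    refine ArchimedeanVectorLattice.archimedean _ (eval T b) fun n hn => ?_
    rw [← Nat.cast_smul_eq_nsmul ℝ]
    exact ih n hn
  | of_add_left => simp [eval]
  | of_smul_left => simp [eval]
  | of_add_right => simp [eval]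
  | of_smul_right => simp [eval]
  | of_abs_left f g hg => simpa [eval, abs] using hT.1 g hg f
  | of_abs_right f g hf => simpa [eval, abs] using hT.2 f hf g

/-- The linear map induced by a vector lattice bimorphism. -/
def lift [ArchimedeanVectorLattice H] (T : E →ₗ[ℝ] F →ₗ[ℝ] H) (hT : IsLatticeBimorphism T) :
    FremlinTensor E F →ₗ[ℝ] H where
  toFun := Quotient.lift (eval T) fun _ _ h => eval_eq hT h
  map_add' x y := by induction x using ind; induction y using ind; rfl
  map_smul' r x := by induction x using ind; rfl

theorem _root_.IsLatticeHom.map_sup' {G : Type*} [AddCommGroup G] [Lattice G] [Module ℝ G]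
    [ArchimedeanVectorLattice G] [ArchimedeanVectorLattice H] {S : G →ₗ[ℝ] H}
    (hS : IsLatticeHom S) (x y : G) : S (x ⊔ y) = S x ⊔ S y := by
  have key : ∀ {K : Type _} [AddCommGroup K] [Lattice K] [Module ℝ K]
      [ArchimedeanVectorLattice K] (x y : K), (2 : ℝ) • (x ⊔ y) = x + y + |y - x| := by
    intro K _ _ _ _ x y
    rw [two_smul, ← two_nsmul, two_nsmul_sup_eq_add_add_abs_sub]
  have key' : (2 : ℝ) • (S x ⊔ S y) = S x + S y + |S y - S x| := by
    rw [two_smul, ← two_nsmul, two_nsmul_sup_eq_add_add_abs_sub]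
  have h2 : (2 : ℝ) • S (x ⊔ y) = (2 : ℝ) • (S x ⊔ S y) := by
    rw [← map_smul, key, key', map_add, map_add, hS, map_sub]
  exact smul_right_injective H (two_ne_zero' ℝ) h2

/-- `FremlinTensor E F` satisfies the defining universal property of the Archimedean vector lattice
tensor product, with test spaces in every universe. -/
theorem isArchimedeanTensorProduct :
    IsArchimedeanTensorProduct.{w} (tmul E F) where
  archimedean := inferInstance
  bimorphism := tmul_bimorphism
  existsUnique_lift H _ _ _ _ T hT := by
    refine ⟨lift T hT, ⟨fun x => ?_, fun f g => rfl⟩, fun S hS => ?_⟩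
    · have : ∀ x y, lift T hT (x ⊔ y) = lift T hT x ⊔ lift T hT y := fun x y => by
        induction x using ind; induction y using ind; rfl
      rw [abs, this, map_neg, ← abs]
    · ext x
      induction x using ind with | _ a
      induction a with
      | of f g => exact hS.2 f g
      | zero => rw [mk_zero, map_zero, map_zero]
      | add a b ha hb => rw [mk_add, map_add, map_add, ha, hb]
      | smul r a ha => rw [mk_smul, map_smul, map_smul, ha]
      | sup a b ha hb =>
        rw [mk_sup, hS.1.map_sup', ha, hb]
        rfl

end Structure

end FremlinTensor

/-! ### Square mean completeness and complex vector lattices -/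

/-- `E` is square mean complete: for all `f, g ∈ E`, the supremum
`f ⊞ g = sup {f cos θ + g sin θ : θ ∈ [0, 2π]}` (which is `√2` times the square mean of
`f` and `g`) exists in `E`. -/
def IsSquareMeanComplete (E : Type u) [AddCommGroup E] [Lattice E] [Module ℝ E] : Prop :=
  ∀ f g : E, ∃ s : E,
    IsLUB {h : E | ∃ θ ∈ Set.Icc 0 (2 * Real.pi), h = Real.cos θ • f + Real.sin θ • g} s

/-- An Archimedean modulus on a complex vector space `V`, in the sense of Mittelmeyer and Wolff. A
complex vector space equipped with one is an Archimedean vector lattice over `ℂ`. -/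
structure IsArchimedeanModulus {V : Type u} [AddCommGroup V] [Module ℂ V] (m : V → V) :
    Prop where
  idempotent : ∀ f, m (m f) = m f
  map_smul : ∀ (α : ℂ) (f : V), m (α • f) = (‖α‖ : ℂ) • m f
  triangle : ∀ f g, m (m (m f + m g) - m (f + g)) = m f + m g - m (f + g)
  span_range : Submodule.span ℂ (Set.range m) = ⊤
  archimedean : ∀ f g, (∀ n : ℕ, 0 < n → m (m g - n • m f) = m g - n • m f) → f = 0

/-- The vector space complexification `E_ℂ = E ⊕ iE = ℂ ⊗ E` is an Archimedean vector lattice over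
`ℂ`: it carries an Archimedean modulus extending the absolute value of `E`. Without reference to
the absolute value of `E` the notion would be void, since every complex vector space carries some
Archimedean modulus (coordinatewise with respect to an algebraic basis). -/
def ComplexificationIsArchimedeanVectorLattice (E : Type u) [AddCommGroup E] [Lattice E]
    [Module ℝ E] : Prop :=
  ∃ m : ℂ ⊗[ℝ] E → ℂ ⊗[ℝ] E,
    IsArchimedeanModulus m ∧ ∀ f : E, m ((1 : ℂ) ⊗ₜ[ℝ] f) = (1 : ℂ) ⊗ₜ[ℝ] |f|

/-!
Both assertions fail for the same reason: some pointwise square mean of two elements of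
`C(X) ⊗ C(Y)` does not come from an element of `C(X) ⊗ C(Y)`.

Evaluation at a point `(x, y)` is a vector lattice homomorphism `evalAt x y` from the Fremlin tensor
product to `ℝ`. Since expressions in the generators involve only finitely many suprema, an element
of the tensor product agrees at each point with one of finitely many functions `∑ fₖ x * gₖ y` of
finite rank (`exists_finite_piecewise_finiteRank`). The uncountable spaces `X` and `Y` contain
Cantor sets; let `a > 0` be an injective continuous function on the Cantor space, and extend `√a` to
`f ∈ C(X)` and `g ∈ C(Y)`. On the product of the Cantor sets the pointwise square mean of `f ⊗ 1`
and `1 ⊗ g` is `√(a x + a y)`. If it came from an element of the tensor product, then by Baire's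
theorem it would coincide with a single function of finite rank on an open rectangle. But the
functions `u ↦ √(u + cⱼ)` with distinct `cⱼ` are linearly independent on every set that accumulates
at a positive point (`coeff_eq_zero_of_frequently_sum_sqrt_eq_zero`), and the rectangle contains
infinitely many `y`. This is `exists_forall_evalAt_ne_sqrt`.

It remains to see that square means and complex moduli are pointwise square means. The supremum of
`f cos θ + g sin θ` is a relatively uniform limit of finite suprema, which vector lattice
homomorphisms preserve (`IsLatticeHom.map_isLUB_eq_sqrt`). A modulus `m` on the complexification
that extends the absolute value takes real values only, so that a real-valued vector lattice
homomorphism `φ` can be applied to them; then `φ ∘ m` is a complex seminorm that equals `|φ|` on real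
vectors, which determines it (`IsArchimedeanModulus.map_tensorRe_eq_sqrt`).
In neither case is it needed that elements of the tensor product are determined by their values at
points.
-/

/-! ### Linear independence of translated square roots -/

open Filter Topology in
theorem sum_sqrt_add_eq_zero_on_pos {ι : Type*} (s : Finset ι) (c l : ι → ℝ) (hc : ∀ j, 0 < c j)
    {u₀ : ℝ} (hu₀ : 0 < u₀) (h : ∃ᶠ u in 𝓝[≠] u₀, ∑ j ∈ s, l j * √(u + c j) = 0)
    {u : ℝ} (hu : 0 < u) : ∑ j ∈ s, l j * √(u + c j) = 0 := by
  have han : AnalyticOnNhd ℝ (fun u : ℝ => ∑ j ∈ s, l j * √(u + c j)) (Set.Ioi 0) := by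
    refine Finset.analyticOnNhd_fun_sum _ fun j _ x hx => ?_
    have hx' : 0 < x + c j := add_pos hx (hc j)
    exact analyticAt_const.mul ((Real.contDiffAt_sqrt hx'.ne').analyticAt.comp_of_eq
      (analyticAt_id.add analyticAt_const) rfl)
  exact han.eqOn_zero_of_preconnected_of_frequently_eq_zero isPreconnected_Ioi hu₀ h hu

/-- Repeated differentiation turns the vanishing of `∑ lⱼ (u + cⱼ) ^ (1/2)` into the vanishing of
`∑ lⱼ (u + cⱼ) ^ (1/2 - k)`, because `1/2 - k` is never zero. -/
theorem sum_rpow_half_sub_eq_zero {ι : Type*} (s : Finset ι) (c l : ι → ℝ) (hc : ∀ j, 0 < c j)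
    (h : ∀ u, 0 < u → ∑ j ∈ s, l j * √(u + c j) = 0) (k : ℕ) :
    ∀ u, 0 < u → ∑ j ∈ s, l j * (u + c j) ^ (1 / 2 - k : ℝ) = 0 := by
  induction k with
  | zero => simpa [Real.sqrt_eq_rpow] using h
  | succ k ih =>
    intro u hu
    have hd : HasDerivAt (fun u : ℝ => ∑ j ∈ s, l j * (u + c j) ^ (1 / 2 - k : ℝ))
        (∑ j ∈ s, l j * ((1 / 2 - k : ℝ) * (u + c j) ^ (1 / 2 - k - 1 : ℝ))) u := by
      refine HasDerivAt.fun_sum fun j _ => HasDerivAt.const_mul _ ?_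
      simpa using ((hasDerivAt_id u).add_const (c j)).rpow_const (p := (1 / 2 - k : ℝ))
        (Or.inl (add_pos hu (hc j)).ne')
    have hz : HasDerivAt (fun u : ℝ => ∑ j ∈ s, l j * (u + c j) ^ (1 / 2 - k : ℝ)) 0 u :=
      (hasDerivAt_const u (0 : ℝ)).congr_of_eventuallyEq
        (Filter.eventually_of_mem (Ioi_mem_nhds hu) fun x hx => ih x hx)
    have hk : (1 / 2 - k : ℝ) ≠ 0 := by
      intro h0
      have h1 : (1 : ℝ) = (2 * k : ℕ) := by push_cast; linarith
      have : 1 = 2 * k := by exact_mod_cast h1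
      omega
    have := hd.unique hz
    simp_rw [mul_left_comm _ (1 / 2 - k : ℝ), ← Finset.mul_sum] at this
    have h2 := (mul_eq_zero.1 this).resolve_left hk
    rw [← h2]
    refine Finset.sum_congr rfl fun j _ => ?_
    push_cast
    ring_nf

open Filter Topology in
/-- The functions `u ↦ √(u + cⱼ)` for distinct `cⱼ > 0` satisfy no linear relation on a set that
accumulates at a positive point: the relation extends to `(0, ∞)` by analyticity, its derivatives
at `1` are the moments of a measure supported on the points `1 / (1 + cⱼ)`, and such a measure
vanishes. -/
theorem coeff_eq_zero_of_frequently_sum_sqrt_eq_zero {ι : Type*} (s : Finset ι)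
    (c l : ι → ℝ) (hc : ∀ j, 0 < c j) (hinj : Function.Injective c) {u₀ : ℝ} (hu₀ : 0 < u₀)
    (h : ∃ᶠ u in 𝓝[≠] u₀, ∑ j ∈ s, l j * √(u + c j) = 0) : ∀ i ∈ s, l i = 0 := by
  classical
  intro i hi
  have hpos : ∀ j, 0 < 1 + c j := fun j => by linarith [hc j]
  set d : ι → ℝ := fun j => (1 + c j)⁻¹
  have hd : Set.InjOn d s := fun a _ b _ hab => hinj (by simpa [d] using hab)
  have hmom (k : ℕ) : ∑ j ∈ s, l j * √(1 + c j) * d j ^ k = 0 := by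
    rw [← sum_rpow_half_sub_eq_zero s c l hc
      (fun u hu => sum_sqrt_add_eq_zero_on_pos s c l hc hu₀ h hu) k 1 one_pos]
    refine Finset.sum_congr rfl fun j _ => ?_
    rw [Real.rpow_sub (hpos j), Real.rpow_natCast, ← Real.sqrt_eq_rpow, inv_pow, mul_assoc,
      div_eq_mul_inv]
  have hpoly (P : Polynomial ℝ) : ∑ j ∈ s, l j * √(1 + c j) * P.eval (d j) = 0 := by
    simp_rw [Polynomial.eval_eq_sum_range, Finset.mul_sum]
    rw [Finset.sum_comm]
    refine Finset.sum_eq_zero fun k _ => ?_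
    simp_rw [mul_left_comm _ (P.coeff k), ← Finset.mul_sum, hmom, mul_zero]
  have := hpoly (Lagrange.basis s d i)
  rw [Finset.sum_eq_single_of_mem i hi, Lagrange.eval_basis_self hd hi, mul_one] at this
  · exact (mul_eq_zero.1 this).resolve_right (Real.sqrt_pos.2 (hpos i)).ne'
  · intro j hj hji
    rw [Lagrange.eval_basis_of_ne hji.symm hj, mul_zero]

/-! ### The Cantor space -/

open Filter Topology in
theorem neBot_nhdsWithin_ne_nat_bool (x : ℕ → Bool) : (𝓝[≠] x).NeBot := by
  have ht : Tendsto (fun n => Function.update x n (!x n)) atTop (𝓝 x) := by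
    rw [tendsto_pi_nhds]
    refine fun k => tendsto_const_nhds.congr' ?_
    filter_upwards [eventually_gt_atTop k] with n hn
    rw [Function.update_of_ne hn.ne]
  refine (tendsto_nhdsWithin_iff.2 ⟨ht, Eventually.of_forall fun n => ?_⟩).neBot
  exact fun hn => by simpa using congrFun hn n

theorem exists_continuous_injective_pos_nat_bool :
    ∃ a : (ℕ → Bool) → ℝ, Continuous a ∧ Function.Injective a ∧ ∀ x, 0 < a x := by
  refine ⟨fun x => 1 + (cantorSetHomeomorphNatToBool.symm x : ℝ), by fun_prop,
    fun x y h => ?_, fun x => ?_⟩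
  · exact cantorSetHomeomorphNatToBool.symm.injective (Subtype.ext (add_left_cancel h))
  · linarith [(cantorSet_subset_unitInterval (cantorSetHomeomorphNatToBool.symm x).2).1]

/-- The function `√(a x + a y)` has infinite rank on every open rectangle of the Cantor space. -/
theorem linearIndependent_sqrt_add {a : (ℕ → Bool) → ℝ} (ha : Continuous a)
    (hinj : Function.Injective a) (hpos : ∀ x, 0 < a x) {U : Set (ℕ → Bool)} (hU : IsOpen U)
    (hne : U.Nonempty) :
    LinearIndependent ℝ fun (y : ℕ → Bool) (x : U) => √(a x + a y) := by
  rw [linearIndependent_iff']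
  intro s l hl
  obtain ⟨p, hp⟩ := hne
  refine coeff_eq_zero_of_frequently_sum_sqrt_eq_zero s a l hpos hinj (hpos p) ?_
  have := neBot_nhdsWithin_ne_nat_bool p
  have ht : Filter.Tendsto a (nhdsWithin p {p}ᶜ) (nhdsWithin (a p) {a p}ᶜ) :=
    (ha.tendsto p).inf (Filter.tendsto_principal_principal.2 fun x hx => hinj.ne hx)
  refine ht.frequently (Filter.Eventually.frequently ?_)
  filter_upwards [mem_nhdsWithin_of_mem_nhds (hU.mem_nhds hp)] with x hx
  simpa using congrFun hl ⟨x, hx⟩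

/-! ### Evaluation at points and finite rank -/

instance Real.instArchimedeanVectorLattice : ArchimedeanVectorLattice ℝ where
  archimedean f g h := by
    by_contra! hf
    obtain ⟨n, hn⟩ := exists_nat_gt (g / f)
    have h1 := h (n + 1) n.succ_pos
    rw [div_lt_iff₀ hf] at hn
    rw [nsmul_eq_mul] at h1
    push_cast at h1
    linarith

theorem IsLatticeHom.monotone {G : Type u} {H : Type v} [AddCommGroup G] [Lattice G] [Module ℝ G]
    [AddCommGroup H] [Lattice H] [Module ℝ H] [ArchimedeanVectorLattice G]
    [ArchimedeanVectorLattice H] {S : G →ₗ[ℝ] H} (hS : IsLatticeHom S) : Monotone S := by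
  intro x y h
  rw [← sup_eq_right] at h ⊢
  rw [← hS.map_sup', h]

section Evaluation

variable {X : Type u} {Y : Type v} [TopologicalSpace X] [TopologicalSpace Y]

/-- The bilinear form `(f, g) ↦ f x * g y` on `C(X) × C(Y)`. -/
def evalBilin (x : X) (y : Y) : C(X, ℝ) →ₗ[ℝ] C(Y, ℝ) →ₗ[ℝ] ℝ :=
  LinearMap.mk₂ ℝ (fun f g => f x * g y) (fun _ _ _ => by simp [add_mul])
    (fun _ _ _ => by simp [mul_assoc]) (fun _ _ _ => by simp [mul_add])
    (fun _ _ _ => by simp [mul_left_comm])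

theorem isLatticeBimorphism_evalBilin (x : X) (y : Y) : IsLatticeBimorphism (evalBilin x y) := by
  refine ⟨fun g hg f => ?_, fun f hf g => ?_⟩
  · change |f| x * g y = |f x * g y|
    rw [abs_mul, abs_of_nonneg (show 0 ≤ g y from hg y), ContinuousMap.abs_apply]
  · change f x * |g| y = |f x * g y|
    rw [abs_mul, abs_of_nonneg (show 0 ≤ f x from hf x), ContinuousMap.abs_apply]

/-- Evaluation at the point `(x, y)`, as a linear form on `C(X) ⊗ C(Y)`. -/
noncomputable def evalAt (x : X) (y : Y) : FremlinTensor C(X, ℝ) C(Y, ℝ) →ₗ[ℝ] ℝ :=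
  FremlinTensor.lift (evalBilin x y) (isLatticeBimorphism_evalBilin x y)

theorem evalAt_tmul (x : X) (y : Y) (f : C(X, ℝ)) (g : C(Y, ℝ)) :
    evalAt x y (FremlinTensor.tmul _ _ f g) = f x * g y := rfl

theorem evalAt_sup (x : X) (y : Y) (z z' : FremlinTensor C(X, ℝ) C(Y, ℝ)) :
    evalAt x y (z ⊔ z') = evalAt x y z ⊔ evalAt x y z' := by
  induction z using FremlinTensor.ind
  induction z' using FremlinTensor.ind
  rfl

theorem isLatticeHom_evalAt (x : X) (y : Y) : IsLatticeHom (evalAt x y) := fun z => by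
  rw [abs, evalAt_sup, map_neg, ← abs]

/-- The finite rank function `(x, y) ↦ ∑ f x * g y`, where `(f, g)` runs through a list. -/
def finiteRankEval (L : List (C(X, ℝ) × C(Y, ℝ))) (x : X) (y : Y) : ℝ :=
  (L.map fun p => p.1 x * p.2 y).sum

theorem continuous_finiteRankEval (L : List (C(X, ℝ) × C(Y, ℝ))) :
    Continuous fun p : X × Y => finiteRankEval L p.1 p.2 := by
  induction L with
  | nil => simpa [finiteRankEval] using continuous_const
  | cons a L ih =>
    simp only [finiteRankEval, List.map_cons, List.sum_cons] at ih ⊢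
    fun_prop

theorem finiteRankEval_append (L M : List (C(X, ℝ) × C(Y, ℝ))) (x : X) (y : Y) :
    finiteRankEval (L ++ M) x y = finiteRankEval L x y + finiteRankEval M x y := by
  simp [finiteRankEval]

theorem finiteRankEval_map_smul (r : ℝ) (L : List (C(X, ℝ) × C(Y, ℝ))) (x : X) (y : Y) :
    finiteRankEval (L.map fun p => (r • p.1, p.2)) x y = r * finiteRankEval L x y := by
  induction L with
  | nil => simp [finiteRankEval]
  | cons a L ih =>
    simp only [finiteRankEval, List.map_cons, List.sum_cons] at ih ⊢
    rw [ih, mul_add, ContinuousMap.smul_apply, smul_eq_mul, mul_assoc]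

/-- As a function on `X × Y`, an element of the Fremlin tensor product is pieced together from
finitely many functions of finite rank, since the supremum of two functions agrees at each point
with one of them. -/
theorem exists_finite_piecewise_finiteRank (z : FremlinTensor C(X, ℝ) C(Y, ℝ)) :
    ∃ P : Set (List (C(X, ℝ) × C(Y, ℝ))), P.Finite ∧
      ∀ x y, ∃ L ∈ P, evalAt x y z = finiteRankEval L x y := by
  induction z using FremlinTensor.ind with | _ a
  induction a with
  | of f g =>
    refine ⟨{[(f, g)]}, Set.finite_singleton _, fun x y => ⟨_, rfl, ?_⟩⟩
    simp [finiteRankEval, ← FremlinTensor.tmul_apply, evalAt_tmul]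
  | zero =>
    refine ⟨{[]}, Set.finite_singleton _, fun x y => ⟨_, rfl, ?_⟩⟩
    simp [finiteRankEval, FremlinTensor.mk_zero]
  | add a b ha hb =>
    obtain ⟨P, hP, h⟩ := ha
    obtain ⟨Q, hQ, h'⟩ := hb
    refine ⟨Set.image2 (· ++ ·) P Q, hP.image2 _ hQ, fun x y => ?_⟩
    obtain ⟨L, hL, hL'⟩ := h x y
    obtain ⟨M, hM, hM'⟩ := h' x y
    refine ⟨_, Set.mem_image2_of_mem hL hM, ?_⟩
    rw [FremlinTensor.mk_add, map_add, hL', hM', finiteRankEval_append]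
  | smul r a ha =>
    obtain ⟨P, hP, h⟩ := ha
    refine ⟨_, hP.image (List.map fun p => (r • p.1, p.2)), fun x y => ?_⟩
    obtain ⟨L, hL, hL'⟩ := h x y
    refine ⟨_, Set.mem_image_of_mem _ hL, ?_⟩
    rw [FremlinTensor.mk_smul, map_smul, hL', finiteRankEval_map_smul, smul_eq_mul]
  | sup a b ha hb =>
    obtain ⟨P, hP, h⟩ := ha
    obtain ⟨Q, hQ, h'⟩ := hb
    refine ⟨P ∪ Q, hP.union hQ, fun x y => ?_⟩
    obtain ⟨L, hL, hL'⟩ := h x y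
    obtain ⟨M, hM, hM'⟩ := h' x y
    rw [FremlinTensor.mk_sup, evalAt_sup]
    rcases max_choice (evalAt x y (FremlinTensor.mk a)) (evalAt x y (FremlinTensor.mk b))
      with h | h
    · exact ⟨L, Or.inl hL, h.trans hL'⟩
    · exact ⟨M, Or.inr hM, h.trans hM'⟩

end Evaluation

/-! ### A square mean outside the tensor product -/

theorem exists_continuous_injective_nat_bool (X : Type u) [TopologicalSpace X] [CompactSpace X]
    [TopologicalSpace.MetrizableSpace X] [Uncountable X] :
    ∃ i : (ℕ → Bool) → X, Continuous i ∧ Function.Injective i := by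
  let _ := TopologicalSpace.metrizableSpaceMetric X
  obtain ⟨i, -, hi⟩ := (isClosed_univ (X := X)).exists_nat_bool_injection_of_not_countable
    Set.not_countable_univ
  exact ⟨i, hi⟩

theorem exists_extension_of_nat_bool {X : Type u} [TopologicalSpace X] [CompactSpace X]
    [TopologicalSpace.MetrizableSpace X] {i : (ℕ → Bool) → X} (hi : Continuous i)
    (hinj : Function.Injective i) {a : (ℕ → Bool) → ℝ} (ha : Continuous a) :
    ∃ f : C(X, ℝ), ∀ x, f (i x) = a x := by
  let _ := TopologicalSpace.metrizableSpaceMetric X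
  obtain ⟨f, hf⟩ := ContinuousMap.exists_extension' (hi.isClosedEmbedding hinj) ⟨a, ha⟩
  exact ⟨f, congrFun hf⟩

theorem finiteRankEval_mem_span {X : Type u} {Y : Type v} [TopologicalSpace X] [TopologicalSpace Y]
    (L : List (C(X, ℝ) × C(Y, ℝ))) {T : Type*} (i : T → X) (y : Y) :
    (fun t => finiteRankEval L (i t) y) ∈
      Submodule.span ℝ ((fun p : C(X, ℝ) × C(Y, ℝ) => fun t => p.1 (i t)) '' {p | p ∈ L}) := by
  have key : ∀ M : List (C(X, ℝ) × C(Y, ℝ)), M ⊆ L → (fun t => finiteRankEval M (i t) y) ∈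
      Submodule.span ℝ ((fun p : C(X, ℝ) × C(Y, ℝ) => fun t => p.1 (i t)) '' {p | p ∈ L}) := by
    intro M
    induction M with
    | nil => exact fun _ => Submodule.zero_mem _
    | cons p M ih =>
      intro hM
      rw [List.cons_subset] at hM
      have : (fun t => finiteRankEval (p :: M) (i t) y) =
          p.2 y • (fun t => p.1 (i t)) + fun t => finiteRankEval M (i t) y := by
        ext t
        simp [finiteRankEval, mul_comm]
      rw [this]
      exact Submodule.add_mem _ (Submodule.smul_mem _ _
        (Submodule.subset_span (Set.mem_image_of_mem _ hM.1))) (ih hM.2)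
  exact key L (List.Subset.refl L)

/-- There are two elements of `C(X) ⊗ C(Y)` whose pointwise square mean does not come from an
element of `C(X) ⊗ C(Y)`. On Cantor sets in `X` and `Y` the square mean is `√(a x + a y)` for an
injective `a`; if it came from the tensor product, then by Baire's theorem it would have finite rank
on an open rectangle. -/
theorem exists_forall_evalAt_ne_sqrt (X : Type u) (Y : Type v)
    [TopologicalSpace X] [CompactSpace X] [TopologicalSpace.MetrizableSpace X] [Uncountable X]
    [TopologicalSpace Y] [CompactSpace Y] [TopologicalSpace.MetrizableSpace Y] [Uncountable Y] :
    ∃ f g : FremlinTensor C(X, ℝ) C(Y, ℝ), ∀ s, ∃ x y,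
      evalAt x y s ≠ √(evalAt x y f ^ 2 + evalAt x y g ^ 2) := by
  obtain ⟨i, hi, hi'⟩ := exists_continuous_injective_nat_bool X
  obtain ⟨j, hj, hj'⟩ := exists_continuous_injective_nat_bool Y
  obtain ⟨a, ha, ha', hpos⟩ := exists_continuous_injective_pos_nat_bool
  obtain ⟨f, hf⟩ := exists_extension_of_nat_bool hi hi' ha.sqrt
  obtain ⟨g, hg⟩ := exists_extension_of_nat_bool hj hj' ha.sqrt
  refine ⟨FremlinTensor.tmul _ _ f 1, FremlinTensor.tmul _ _ 1 g, fun s => ?_⟩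
  by_contra! h
  obtain ⟨P, hP, hs⟩ := exists_finite_piecewise_finiteRank s
  have := hP.to_subtype
  let A : P → Set ((ℕ → Bool) × (ℕ → Bool)) := fun L =>
    {p | √(a p.1 + a p.2) = finiteRankEval L.1 (i p.1) (j p.2)}
  have hA (L : P) : IsClosed (A L) := by
    refine isClosed_eq (by fun_prop) ?_
    exact (continuous_finiteRankEval L.1).comp
      ((hi.comp continuous_fst).prodMk (hj.comp continuous_snd))
  have hcov : ⋃ L, A L = Set.univ := by
    refine Set.eq_univ_of_forall fun p => Set.mem_iUnion.2 ?_
    obtain ⟨L, hL, hL'⟩ := hs (i p.1) (j p.2)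
    refine ⟨⟨L, hL⟩, ?_⟩
    change _ = finiteRankEval L (i p.1) (j p.2)
    rw [← hL', h, evalAt_tmul, evalAt_tmul, hf, hg]
    simp [Real.sq_sqrt (hpos _).le]
  obtain ⟨L, ⟨x, y⟩, hxy⟩ := nonempty_interior_of_iUnion_of_closed hA hcov
  obtain ⟨U, V, hU, hV, hxU, hyV, hUV⟩ := isOpen_prod_iff.1 isOpen_interior x y hxy
  have hlin := (linearIndependent_sqrt_add ha ha' hpos hU ⟨x, hxU⟩).comp
    (fun y : V => (y : ℕ → Bool)) Subtype.val_injective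
  have hL := ((List.finite_toSet L.1).image
    fun (p : C(X, ℝ) × C(Y, ℝ)) (t : U) => p.1 (i t)).to_subtype
  have hfin := hlin.finite_of_le_span_finite _
    ((fun p : C(X, ℝ) × C(Y, ℝ) => fun t : U => p.1 (i t)) '' {p | p ∈ L.1}) ?_
  · have := neBot_nhdsWithin_ne_nat_bool y
    exact infinite_of_mem_nhds y (hV.mem_nhds hyV) (Set.toFinite V)
  · rintro _ ⟨⟨y', hy'⟩, rfl⟩
    have : (fun t : U => √(a t + a y')) = fun t : U => finiteRankEval L.1 (i t) (j y') :=
      funext fun t => (interior_subset (s := A L) (hUV (Set.mk_mem_prod t.2 hy')) :)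
    change (fun t : U => √(a t + a y')) ∈ _
    rw [this]
    exact finiteRankEval_mem_span L.1 (fun t : U => i t) (j y')

/-! ### Square means as suprema -/

theorem Real.exists_eq_cos_mul_add_sin_mul (a b : ℝ) :
    ∃ θ ∈ Set.Icc 0 (2 * Real.pi), Real.cos θ * a + Real.sin θ * b = √(a ^ 2 + b ^ 2) := by
  set z : ℂ := ⟨a, b⟩
  have hz : ‖z‖ = √(a ^ 2 + b ^ 2) := by
    rw [Complex.norm_def, Complex.normSq_apply]
    simp only [z, sq]
  have hc : ‖z‖ * Real.cos z.arg = a := Complex.norm_mul_cos_arg z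
  have hs : ‖z‖ * Real.sin z.arg = b := Complex.norm_mul_sin_arg z
  have key : Real.cos z.arg * a + Real.sin z.arg * b = ‖z‖ := by
    calc _ = ‖z‖ * (Real.cos z.arg ^ 2 + Real.sin z.arg ^ 2) := by
          nth_rw 1 [← hc, ← hs]; ring
      _ = ‖z‖ := by rw [Real.cos_sq_add_sin_sq, mul_one]
  rw [← hz]
  rcases le_or_gt 0 z.arg with h | h
  · exact ⟨z.arg, ⟨h, by linarith [Complex.arg_le_pi z, Real.pi_pos]⟩, key⟩
  · refine ⟨z.arg + 2 * Real.pi, ⟨by linarith [Complex.neg_pi_lt_arg z, Real.pi_pos],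
      by linarith⟩, ?_⟩
    rwa [Real.cos_add_two_pi, Real.sin_add_two_pi]

theorem Real.cos_mul_add_sin_mul_le_sqrt (θ a b : ℝ) :
    Real.cos θ * a + Real.sin θ * b ≤ √(a ^ 2 + b ^ 2) := by
  refine Real.le_sqrt_of_sq_le ?_
  nlinarith [sq_nonneg (Real.cos θ * b - Real.sin θ * a), Real.cos_sq_add_sin_sq θ]

section LatticeHom

variable {E : Type u} [AddCommGroup E] [Lattice E] [Module ℝ E] [ArchimedeanVectorLattice E]

theorem smul_le_smul_abs_of_abs_le {r c : ℝ} (h : |r| ≤ c) (f : E) : r • f ≤ c • |f| := by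
  have hc : 0 ≤ c := (abs_nonneg r).trans h
  have h3 : (c + r) • f - (c - r) • f ≤ (c + r) • |f| + (c - r) • |f| := by
    have h1' : -((c - r) • f) ≤ (c - r) • |f| := by
      rw [← smul_neg]
      exact smul_le_smul_of_nonneg_left (neg_le_abs f) (by linarith [le_abs_self r])
    have h2' : (c + r) • f ≤ (c + r) • |f| :=
      smul_le_smul_of_nonneg_left (le_abs_self f) (by linarith [neg_abs_le r])
    rw [sub_eq_add_neg]
    exact add_le_add h2' h1'
  rw [← sub_smul, ← add_smul] at h3
  have h4 := smul_le_smul_of_nonneg_left h3 (show (0 : ℝ) ≤ 1 / 2 by norm_num)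
  rw [smul_smul, smul_smul] at h4
  convert h4 using 2 <;> ring

theorem exists_upperBound_map_le (φ : E →ₗ[ℝ] ℝ) (hφ : IsLatticeHom φ) (a : ℕ → E) {R : ℝ}
    (hR : ∀ k, φ (a k) ≤ R) (n : ℕ) : ∃ t, (∀ k ≤ n, a k ≤ t) ∧ φ t ≤ R := by
  induction n with
  | zero => exact ⟨a 0, fun k hk => by rw [Nat.le_zero.1 hk], hR 0⟩
  | succ n ih =>
    obtain ⟨t, ht, ht'⟩ := ih
    refine ⟨t ⊔ a (n + 1), fun k hk => ?_, ?_⟩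
    · rcases Nat.le_succ_iff.1 hk with h | rfl
      · exact (ht k h).trans le_sup_left
      · exact le_sup_right
    · rw [hφ.map_sup']
      exact sup_le ht' (hR _)

/-- Real-valued vector lattice homomorphisms preserve the supremum that defines a square mean,
although they need not preserve infinite suprema: this one is a relatively uniform limit of
finite suprema. -/
theorem IsLatticeHom.map_isLUB_eq_sqrt {φ : E →ₗ[ℝ] ℝ} (hφ : IsLatticeHom φ) {f g s : E}
    (hs : IsLUB {h : E | ∃ θ ∈ Set.Icc 0 (2 * Real.pi), h = Real.cos θ • f + Real.sin θ • g} s) :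
    φ s = √(φ f ^ 2 + φ g ^ 2) := by
  apply le_antisymm
  · have hpi := Real.pi_pos
    set C : ℝ := 2 * Real.pi * (|φ f| + |φ g|) with hC
    have key (n : ℕ) : φ s ≤ √(φ f ^ 2 + φ g ^ 2) + C / (n + 1) := by
      -- The angles `k * δ` with `k ≤ n` come within `δ` of every angle in `[0, 2π)`.
      set δ : ℝ := 2 * Real.pi / (n + 1) with hδ
      have hn : (0 : ℝ) < n + 1 := by positivity
      have hδ0 : 0 < δ := by positivity
      obtain ⟨t, ht, ht'⟩ := exists_upperBound_map_le φ hφ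
        (fun k : ℕ => Real.cos (k * δ) • f + Real.sin (k * δ) • g)
        (R := √(φ f ^ 2 + φ g ^ 2))
        (fun k => by simpa using Real.cos_mul_add_sin_mul_le_sqrt (k * δ) (φ f) (φ g)) (n + 1)
      have hle : s ≤ t + δ • (|f| + |g|) := by
        refine hs.2 ?_
        rintro _ ⟨θ, ⟨h0, h1⟩, rfl⟩
        have hk : ⌊θ / δ⌋₊ ≤ n + 1 := by
          refine Nat.floor_le_of_le ?_
          rw [div_le_iff₀ hδ0, hδ]
          push_cast
          rwa [mul_div_cancel₀ _ hn.ne']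
        have hθ : |θ - ⌊θ / δ⌋₊ * δ| ≤ δ := by
          have h2 := Nat.floor_le (div_nonneg h0 hδ0.le)
          have h3 := Nat.lt_floor_add_one (θ / δ)
          rw [le_div_iff₀ hδ0] at h2
          rw [div_lt_iff₀ hδ0] at h3
          rw [abs_le]
          constructor <;> linarith
        have hcos : |Real.cos θ - Real.cos (⌊θ / δ⌋₊ * δ)| ≤ δ :=
          (Real.abs_cos_sub_cos_le _ _).trans hθ
        have hsin : |Real.sin θ - Real.sin (⌊θ / δ⌋₊ * δ)| ≤ δ :=
          (Real.abs_sin_sub_sin_le _ _).trans hθ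
        have h4 := add_le_add (ht _ hk) (add_le_add (smul_le_smul_abs_of_abs_le hcos f)
          (smul_le_smul_abs_of_abs_le hsin g))
        rw [← smul_add] at h4
        refine le_of_eq_of_le ?_ h4
        module
      have := hφ.monotone hle
      rw [map_add, map_smul, map_add, hφ f, hφ g, smul_eq_mul] at this
      have hCδ : C / (n + 1) = δ * (|φ f| + |φ g|) := by rw [hC, hδ]; ring
      linarith
    have hlim : Filter.Tendsto (fun n : ℕ => √(φ f ^ 2 + φ g ^ 2) + C / (n + 1)) Filter.atTop
        (nhds (√(φ f ^ 2 + φ g ^ 2) + 0)) := by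
      refine tendsto_const_nhds.add ?_
      simpa [div_eq_mul_inv] using tendsto_one_div_add_atTop_nhds_zero_nat.const_mul C
    rw [add_zero] at hlim
    exact ge_of_tendsto' hlim key
  · obtain ⟨θ, hθ, h⟩ := Real.exists_eq_cos_mul_add_sin_mul (φ f) (φ g)
    rw [← h]
    simpa using hφ.monotone (hs.1 ⟨θ, hθ, rfl⟩)

end LatticeHom

/-! ### Moduli on a complexification -/

namespace IsArchimedeanModulus

variable {V : Type u} [AddCommGroup V] [Module ℂ V] {m : V → V}

theorem map_zero (hm : IsArchimedeanModulus m) : m 0 = 0 := by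
  simpa using hm.map_smul 0 0

theorem map_neg (hm : IsArchimedeanModulus m) (f : V) : m (-f) = m f := by
  simpa using hm.map_smul (-1) f

/-- The positive cone of a modulus `m`: the vectors that `m` fixes. -/
def cone (hm : IsArchimedeanModulus m) : AddSubmonoid V where
  carrier := {v | m v = v}
  zero_mem' := hm.map_zero
  add_mem' := fun {f g} hf hg => by
    have := hm.triangle f g
    rw [hf.out, hg.out, sub_self, hm.map_zero] at this
    exact (sub_eq_zero.1 this.symm).symm

theorem mem_cone (hm : IsArchimedeanModulus m) {v : V} : v ∈ hm.cone ↔ m v = v := Iff.rfl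

theorem apply_mem_cone (hm : IsArchimedeanModulus m) (v : V) : m v ∈ hm.cone := hm.idempotent v

theorem smul_mem_cone (hm : IsArchimedeanModulus m) {v : V} (hv : v ∈ hm.cone) {r : ℝ}
    (hr : 0 ≤ r) : (r : ℂ) • v ∈ hm.cone := by
  rw [mem_cone] at hv ⊢
  rw [hm.map_smul, hv, Complex.norm_real, Real.norm_of_nonneg hr]

theorem eq_zero_of_mem_cone_of_neg_mem_cone (hm : IsArchimedeanModulus m) {v : V}
    (hv : v ∈ hm.cone) (hv' : -v ∈ hm.cone) : v = 0 := by
  rw [mem_cone] at hv hv'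
  rw [hm.map_neg, hv] at hv'
  calc v = (1 / 2 : ℂ) • (v + v) := by module
    _ = 0 := by nth_rw 2 [hv']; simp

/-- The triangle inequality, in the order given by the cone. -/
theorem add_sub_mem_cone (hm : IsArchimedeanModulus m) (f g : V) :
    m f + m g - m (f + g) ∈ hm.cone := by
  have h := hm.triangle f g
  rwa [hm.mem_cone.1 (add_mem (hm.apply_mem_cone f) (hm.apply_mem_cone g))] at h

/-- On differences of elements of the cone, `v ≤ m v`. -/
theorem sub_mem_cone_of_eq_sub (hm : IsArchimedeanModulus m) {v p q : V} (hp : p ∈ hm.cone)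
    (hq : q ∈ hm.cone) (hv : v = p - q) : m v - v ∈ hm.cone := by
  have h := hm.add_sub_mem_cone v q
  rw [hm.mem_cone.1 hq, show v + q = p by rw [hv, sub_add_cancel], hm.mem_cone.1 hp] at h
  convert h using 1
  rw [hv]
  abel

/-- If `v ≤ w` and `-v ≤ w`, then `m v ≤ w`. -/
theorem sub_apply_mem_cone (hm : IsArchimedeanModulus m) {v w : V} (h₁ : w + v ∈ hm.cone)
    (h₂ : w - v ∈ hm.cone) : w - m v ∈ hm.cone := by
  have h := hm.add_sub_mem_cone (w + v) (-(w - v))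
  rw [hm.map_neg, hm.mem_cone.1 h₁, hm.mem_cone.1 h₂,
    show w + v + -(w - v) = (2 : ℂ) • v by module, hm.map_smul] at h
  convert hm.smul_mem_cone h (r := 1 / 2) (by norm_num) using 1
  push_cast
  rw [Complex.norm_ofNat]
  push_cast
  module

/-- If `v` and `I • v` both lie between `-m v` and `m v`, then `m v = 0`. In any vector lattice
`|u + v| + |u - v| = 2 (|u| ⊔ |v|)`; for `u = I • v` the left hand side is `2√2 |v|` and the
right hand side is `2 |v|`. -/
theorem apply_eq_zero_of_mem_cone (hm : IsArchimedeanModulus m) {v : V}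
    (h₁ : m v - v ∈ hm.cone) (h₂ : m v + v ∈ hm.cone) (h₃ : m v - Complex.I • v ∈ hm.cone)
    (h₄ : m v + Complex.I • v ∈ hm.cone) : m v = 0 := by
  set c := m v with hc
  set u := Complex.I • v with hu
  have hn1 : ‖Complex.I + 1‖ = √2 := by
    rw [Complex.norm_def, Complex.normSq_apply]; norm_num
  have hn2 : ‖Complex.I - 1‖ = √2 := by
    rw [Complex.norm_def, Complex.normSq_apply]; norm_num
  have hadd : m (u + v) = ((√2 : ℝ) : ℂ) • c := by
    rw [hu, show Complex.I • v + v = (Complex.I + 1) • v by module, hm.map_smul, hn1]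
  have hsub : m (u - v) = ((√2 : ℝ) : ℂ) • c := by
    rw [hu, show Complex.I • v - v = (Complex.I - 1) • v by module, hm.map_smul, hn2]
  have k₁ : (c + c - (u + v)) - m (u - v) ∈ hm.cone := by
    refine hm.sub_apply_mem_cone ?_ ?_
    · convert add_mem h₁ h₁ using 1; abel
    · convert add_mem h₃ h₃ using 1; abel
  have k₂ : (c + c + (u + v)) - m (u - v) ∈ hm.cone := by
    refine hm.sub_apply_mem_cone ?_ ?_
    · convert add_mem h₄ h₄ using 1; abel
    · convert add_mem h₂ h₂ using 1; abel
  have k₃ : (c + c - m (u - v)) - m (u + v) ∈ hm.cone := by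
    refine hm.sub_apply_mem_cone ?_ ?_
    · convert k₂ using 1; abel
    · convert k₁ using 1; abel
  rw [hadd, hsub] at k₃
  have hs : (1 : ℝ) < √2 := Real.lt_sqrt_of_sq_lt (by norm_num)
  have hs' : 2 * √2 - 2 ≠ 0 := by linarith
  refine hm.eq_zero_of_mem_cone_of_neg_mem_cone (hm.apply_mem_cone v) ?_
  convert hm.smul_mem_cone k₃ (r := (2 * √2 - 2)⁻¹) (by rw [inv_nonneg]; linarith) using 1
  rw [show c + c - ((√2 : ℝ) : ℂ) • c - ((√2 : ℝ) : ℂ) • c = ((-(2 * √2 - 2) : ℝ) : ℂ) • c by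
    push_cast; module, smul_smul, ← Complex.ofReal_mul, mul_neg, inv_mul_cancel₀ hs']
  simp

end IsArchimedeanModulus

section Complexification

variable {E : Type u} [AddCommGroup E] [Module ℝ E]

variable (E) in
/-- The real part `ℂ ⊗ E → E`. -/
noncomputable def tensorRe : ℂ ⊗[ℝ] E →ₗ[ℝ] E :=
  TensorProduct.lift (LinearMap.lsmul ℝ E ∘ₗ Complex.reLm)

variable (E) in
/-- The imaginary part `ℂ ⊗ E → E`. -/
noncomputable def tensorIm : ℂ ⊗[ℝ] E →ₗ[ℝ] E :=
  TensorProduct.lift (LinearMap.lsmul ℝ E ∘ₗ Complex.imLm)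

theorem tensorRe_tmul (z : ℂ) (f : E) : tensorRe E (z ⊗ₜ f) = z.re • f := rfl

theorem tensorIm_tmul (z : ℂ) (f : E) : tensorIm E (z ⊗ₜ f) = z.im • f := rfl

theorem one_tmul_re_add_I_smul_one_tmul_im (v : ℂ ⊗[ℝ] E) :
    (1 : ℂ) ⊗ₜ[ℝ] tensorRe E v + Complex.I • (1 : ℂ) ⊗ₜ[ℝ] tensorIm E v = v := by
  induction v with
  | zero => simp
  | tmul z f =>
    rw [tensorRe_tmul, tensorIm_tmul, TensorProduct.smul_tmul', ← TensorProduct.smul_tmul,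
      ← TensorProduct.smul_tmul, ← TensorProduct.add_tmul]
    congr 1
    apply Complex.ext <;> simp
  | add v w hv hw =>
    rw [map_add, map_add, TensorProduct.tmul_add, TensorProduct.tmul_add, smul_add,
      add_add_add_comm, hv, hw]

theorem one_tmul_injective : Function.Injective fun f : E => (1 : ℂ) ⊗ₜ[ℝ] f := fun f g h => by
  simpa [tensorRe_tmul] using congrArg (tensorRe E) h

theorem ofReal_smul_one_tmul (r : ℝ) (f : E) :
    (r : ℂ) • (1 : ℂ) ⊗ₜ[ℝ] f = (1 : ℂ) ⊗ₜ[ℝ] (r • f) := by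
  rw [TensorProduct.smul_tmul', ← TensorProduct.smul_tmul]
  simp

variable [Lattice E] [ArchimedeanVectorLattice E] {m : ℂ ⊗[ℝ] E → ℂ ⊗[ℝ] E}

theorem IsArchimedeanModulus.one_tmul_mem_cone (hm : IsArchimedeanModulus m)
    (hext : ∀ f : E, m ((1 : ℂ) ⊗ₜ[ℝ] f) = (1 : ℂ) ⊗ₜ[ℝ] |f|) {f : E} :
    (1 : ℂ) ⊗ₜ[ℝ] f ∈ hm.cone ↔ 0 ≤ f := by
  rw [hm.mem_cone, hext]
  refine ⟨fun h => ?_, fun h => by rw [abs_of_nonneg h]⟩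
  rw [← one_tmul_injective h]
  exact abs_nonneg f

/-- The cone of a modulus that extends the absolute value consists of real vectors. If
`p = a + i b` is in the cone, then `i b` is, like `b`, a difference of elements of the cone. -/
theorem IsArchimedeanModulus.tensorIm_eq_zero (hm : IsArchimedeanModulus m)
    (hext : ∀ f : E, m ((1 : ℂ) ⊗ₜ[ℝ] f) = (1 : ℂ) ⊗ₜ[ℝ] |f|) {p : ℂ ⊗[ℝ] E}
    (hp : p ∈ hm.cone) : tensorIm E p = 0 := by
  set a := tensorRe E p with ha
  set b := tensorIm E p with hb
  have hpab : p = (1 : ℂ) ⊗ₜ[ℝ] a + Complex.I • (1 : ℂ) ⊗ₜ[ℝ] b :=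
    (one_tmul_re_add_I_smul_one_tmul_im p).symm
  have hmI : m (Complex.I • (1 : ℂ) ⊗ₜ[ℝ] b) = m ((1 : ℂ) ⊗ₜ[ℝ] b) := by
    rw [hm.map_smul, Complex.norm_I, Complex.ofReal_one, one_smul]
  have hpos := (hm.one_tmul_mem_cone hext).2 (posPart_nonneg a)
  have hneg := add_mem hp ((hm.one_tmul_mem_cone hext).2 (negPart_nonneg a))
  have hI : Complex.I • (1 : ℂ) ⊗ₜ[ℝ] b =
      p + (1 : ℂ) ⊗ₜ[ℝ] a⁻ - (1 : ℂ) ⊗ₜ[ℝ] a⁺ := by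
    rw [hpab]
    nth_rw 1 [← posPart_sub_negPart a]
    rw [TensorProduct.tmul_sub]
    abel
  have h₃ := hm.sub_mem_cone_of_eq_sub hneg hpos hI
  have h₄ := hm.sub_mem_cone_of_eq_sub hpos hneg (v := -(Complex.I • (1 : ℂ) ⊗ₜ[ℝ] b))
    (by rw [hI]; abel)
  rw [hmI] at h₃
  rw [hm.map_neg, hmI, sub_neg_eq_add] at h₄
  have hb0 : m ((1 : ℂ) ⊗ₜ[ℝ] b) = 0 := by
    refine hm.apply_eq_zero_of_mem_cone ?_ ?_ h₃ h₄
    · rw [hext, ← TensorProduct.tmul_sub, hm.one_tmul_mem_cone hext]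
      exact sub_nonneg.2 (le_abs_self b)
    · rw [hext, ← TensorProduct.tmul_add, hm.one_tmul_mem_cone hext]
      exact neg_le_iff_add_nonneg.1 (neg_le_abs b)
  rw [hext, ← TensorProduct.tmul_zero E (1 : ℂ)] at hb0
  have hb1 : |b| = 0 := one_tmul_injective hb0
  exact le_antisymm (hb1 ▸ le_abs_self b) (neg_nonpos.1 (hb1 ▸ neg_le_abs b))

theorem IsArchimedeanModulus.one_tmul_re_apply (hm : IsArchimedeanModulus m)
    (hext : ∀ f : E, m ((1 : ℂ) ⊗ₜ[ℝ] f) = (1 : ℂ) ⊗ₜ[ℝ] |f|) (v : ℂ ⊗[ℝ] E) :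
    (1 : ℂ) ⊗ₜ[ℝ] tensorRe E (m v) = m v := by
  have h := one_tmul_re_add_I_smul_one_tmul_im (m v)
  rwa [hm.tensorIm_eq_zero hext (hm.apply_mem_cone v), TensorProduct.tmul_zero, smul_zero,
    add_zero] at h

theorem IsArchimedeanModulus.tensorRe_nonneg (hm : IsArchimedeanModulus m)
    (hext : ∀ f : E, m ((1 : ℂ) ⊗ₜ[ℝ] f) = (1 : ℂ) ⊗ₜ[ℝ] |f|) {p : ℂ ⊗[ℝ] E}
    (hp : p ∈ hm.cone) : 0 ≤ tensorRe E p := by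
  rw [← hm.one_tmul_mem_cone hext, ← hm.mem_cone.1 hp, hm.one_tmul_re_apply hext, hm.mem_cone.1 hp]
  exact hp

/-- A modulus that extends the absolute value is given by square means, as far as real-valued
vector lattice homomorphisms `φ` can see. Indeed `φ ∘ m` is a complex seminorm that is `|φ|` on
real vectors; hence it vanishes on the complexification of the kernel of `φ`, and its value at a
vector depends only on the value of `φ` there. -/
theorem IsArchimedeanModulus.map_tensorRe_eq_sqrt (hm : IsArchimedeanModulus m)
    (hext : ∀ f : E, m ((1 : ℂ) ⊗ₜ[ℝ] f) = (1 : ℂ) ⊗ₜ[ℝ] |f|) {φ : E →ₗ[ℝ] ℝ}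
    (hφ : IsLatticeHom φ) {e : E} (he : φ e = 1) (f g : E) :
    φ (tensorRe E (m ((1 : ℂ) ⊗ₜ[ℝ] f + Complex.I • (1 : ℂ) ⊗ₜ[ℝ] g))) =
      √(φ f ^ 2 + φ g ^ 2) := by
  set p : ℂ ⊗[ℝ] E → ℝ := fun v => φ (tensorRe E (m v)) with hp
  have hadd (v w) : p (v + w) ≤ p v + p w := by
    have h := hφ.monotone (hm.tensorRe_nonneg hext (hm.add_sub_mem_cone v w))
    simp only [map_add, map_sub] at h
    simpa [hp] using h
  have hsmul (z : ℂ) (v) : p (z • v) = ‖z‖ * p v := by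
    simp only [hp]
    rw [hm.map_smul, ← hm.one_tmul_re_apply hext v, ofReal_smul_one_tmul]
    simp only [tensorRe_tmul, Complex.one_re, one_smul, _root_.map_smul, smul_eq_mul]
  have hreal (f : E) : p ((1 : ℂ) ⊗ₜ[ℝ] f) = |φ f| := by
    simp only [hp]
    rw [hext, tensorRe_tmul, Complex.one_re, one_smul, hφ]
  set z : ℂ := ⟨φ f, φ g⟩ with hz
  set v := (1 : ℂ) ⊗ₜ[ℝ] f + Complex.I • (1 : ℂ) ⊗ₜ[ℝ] g with hv
  set v₀ := z • (1 : ℂ) ⊗ₜ[ℝ] e with hv₀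
  set d := (1 : ℂ) ⊗ₜ[ℝ] (f - φ f • e) + Complex.I • (1 : ℂ) ⊗ₜ[ℝ] (g - φ g • e) with hd
  have hvd : v = v₀ + d := by
    have hz' : z = (φ f : ℂ) + Complex.I * (φ g : ℂ) := by
      apply Complex.ext <;> simp [hz]
    rw [hv, hv₀, hd, hz', TensorProduct.tmul_sub, TensorProduct.tmul_sub,
      ← ofReal_smul_one_tmul, ← ofReal_smul_one_tmul]
    module
  have hker (f : E) : p ((1 : ℂ) ⊗ₜ[ℝ] (f - φ f • e)) = 0 := by
    rw [hreal, map_sub, _root_.map_smul, he, smul_eq_mul, mul_one, sub_self, abs_zero]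
  have hpd : p d ≤ 0 := by
    refine (hadd _ _).trans ?_
    rw [hsmul, hker, hker, mul_zero, add_zero]
  have hpd' : p (-d) ≤ 0 := by
    rw [show -d = (-1 : ℂ) • d by simp, hsmul]
    simpa using hpd
  have hpv₀ : p v₀ = √(φ f ^ 2 + φ g ^ 2) := by
    rw [hsmul, hreal, he, abs_one, mul_one, Complex.norm_def, Complex.normSq_apply]
    simp only [hz, sq]
  have h₁ : p v ≤ p v₀ + p d := hvd ▸ hadd v₀ d
  have h₂ : p v₀ ≤ p v + p (-d) := by
    have := hadd v (-d)
    rwa [hvd, add_neg_cancel_right, ← hvd] at this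
  change p v = _
  linarith

end Complexification

/-! ### Failure of square mean completeness -/

theorem theorem4p11 (X : Type u) (Y : Type v)
    [TopologicalSpace X] [CompactSpace X] [TopologicalSpace.MetrizableSpace X] [Uncountable X]
    [TopologicalSpace Y] [CompactSpace Y] [TopologicalSpace.MetrizableSpace Y] [Uncountable Y] :
    ¬ IsSquareMeanComplete (FremlinTensor C(X, ℝ) C(Y, ℝ)) ∧
      ¬ ComplexificationIsArchimedeanVectorLattice (FremlinTensor C(X, ℝ) C(Y, ℝ)) := by
  obtain ⟨f, g, hfg⟩ := exists_forall_evalAt_ne_sqrt X Y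
  constructor
  · intro h
    obtain ⟨s, hs⟩ := h f g
    obtain ⟨x, y, hxy⟩ := hfg s
    exact hxy ((isLatticeHom_evalAt x y).map_isLUB_eq_sqrt hs)
  · rintro ⟨m, hm, hext⟩
    obtain ⟨x, y, hxy⟩ := hfg (tensorRe _ (m ((1 : ℂ) ⊗ₜ[ℝ] f + Complex.I • (1 : ℂ) ⊗ₜ[ℝ] g)))
    refine hxy (hm.map_tensorRe_eq_sqrt hext (isLatticeHom_evalAt x y)
      (e := FremlinTensor.tmul _ _ 1 1) ?_ f g)
    rw [evalAt_tmul, ContinuousMap.one_apply, ContinuousMap.one_apply, mul_one]
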